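/- Let $L$ be a finite extension of $\mathbb{Q}_p$. An $L$-vector space $V$ with a topology is \emph{of compact type} if $V=\varinjlim_{m\in\mathbb{N}}V_m$ is the locally convex inductive limit of a sequence of (nonarchimedean) $L$-Banach spaces $V_m$ with injective compact linear transition maps $V_m\to V_{m+1}$. A \emph{compact type algebra} is a topological $L$-algebra $A=\varinjlim_m A_m$ that is the locally convex inductive limit of a sequence of (nonarchimedean) $L$-Banach algebras $A_m$ whose transition maps $A_m\to A_{m+1}$ are injective compact homomorphisms of $L$-algebras. All rings are associative with unit and all modules are left modules. Let $A=\varinjlim_m A_m$ be a compact type algebra such that all the Banach algebras $A_m$ are (left) noetherian. (i) Each finitely generated $A$-module $M$ carries a unique compact type topology (called its canonical topology) for which the structure map $A\times M\to M$ is continuous. Moreover, for this topology one can write $M=\varinjlim_m M_m$ as a locally convex inductive limit of Banach spaces with injective compact transition maps as above, where each $M_m$ is a finitely generated $A_m$-submodule of $M$. (ii) Every finitely generated $A$-submodule of a finitely generated $A$-module $M$ is closed in the canonical topology of $M$. (iii) Any $A$-linear map between finitely generated $A$-modules is continuous and strict with closed image for the canonical topologies. (iv) If an $A$-module $M$ admits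 a finite presentation $A^{\oplus s}\to A^{\oplus r}\xrightarrow{f}M\to 0$, then the quotient topology on $M\simeq A^{\oplus r}/\ker(f)$ coincides with the canonical topology of $M$. -/

import Mathlib

open Topology

universe uM uN

/-- A locally convex topology (in the nonarchimedean sense) on the `L`-vector space `E` that is
the locally convex inductive limit topology for the linear maps `j m : V m → E`: the lattices
(i.e. submodules over the ring `{c : L | ‖c‖ ≤ 1}`) of `E` whose preimages in all the `V m` are
open form a basis of neighbourhoods of `0`. (When `E` is the union of the images, such a lattice
is automatically absorbing.) This is the finest locally convex topology on `E` for which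
all the `j m` are continuous. -/
structure IsLocallyConvexLimitTopology (L : Type*) [NontriviallyNormedField L]
    {V : ℕ → Type*} [∀ m, NormedAddCommGroup (V m)] [∀ m, NormedSpace L (V m)]
    {E : Type*} [AddCommGroup E] [Module L E] [TopologicalSpace E]
    (j : ∀ m, V m →ₗ[L] E) : Prop where
  isTopologicalAddGroup : IsTopologicalAddGroup E
  nhds_zero : (nhds (0 : E)).HasBasis
    (fun N : AddSubgroup E =>
      (∀ c : L, ‖c‖ ≤ 1 → ∀ x ∈ N, c • x ∈ N) ∧ ∀ m, IsOpen (j m ⁻¹' (N : Set E)))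
    (fun N => (N : Set E))

/-- The topological `L`-vector space `E` is, through the maps `j m`, the locally convex inductive
limit of the `L`-Banach spaces `V m` along the injective compact linear maps `φ m`.
As always over a nonarchimedean field, the norm of a Banach space is ultrametric.
The fields `map_comp`, `injective` and `exists_eq` say that `E` is the direct limit of the `V m`
as a vector space. -/
structure IsCompactTypeLimit (L : Type*) [NontriviallyNormedField L]
    {V : ℕ → Type*} [∀ m, NormedAddCommGroup (V m)] [∀ m, NormedSpace L (V m)]
    {E : Type*} [AddCommGroup E] [Module L E] [TopologicalSpace E]
    (φ : ∀ m, V m →ₗ[L] V (m + 1)) (j : ∀ m, V m →ₗ[L] E) : Prop where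
  isUltrametricDist : ∀ m, IsUltrametricDist (V m)
  completeSpace : ∀ m, CompleteSpace (V m)
  transition_injective : ∀ m, Function.Injective (φ m)
  transition_compact : ∀ m, IsCompactOperator (φ m)
  map_comp : ∀ m, j (m + 1) ∘ₗ φ m = j m
  injective : ∀ m, Function.Injective (j m)
  exists_eq : ∀ v : E, ∃ m, ∃ x : V m, j m x = v
  topology : IsLocallyConvexLimitTopology L j

/-- The topological `L`-vector space `E` is of compact type. The Banach spaces embed into `E`,
so nothing is lost by taking them in the universe of `E`. -/
def IsCompactType (L : Type*) [NontriviallyNormedField L]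
    (E : Type uM) [AddCommGroup E] [Module L E] [TopologicalSpace E] : Prop :=
  ∃ (V : ℕ → Type uM) (_ : ∀ m, NormedAddCommGroup (V m)) (_ : ∀ m, NormedSpace L (V m))
    (φ : ∀ m, V m →ₗ[L] V (m + 1)) (j : ∀ m, V m →ₗ[L] E), IsCompactTypeLimit L φ j

/-- The topological `L`-algebra `A` is, through the algebra maps `ι m`, a compact type algebra:
multiplication is jointly continuous and `A` is the locally convex inductive limit of the Banach
algebras `B m` along the injective compact algebra maps `φ m`. -/
structure IsCompactTypeAlgebra (L : Type*) [NontriviallyNormedField L]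
    {B : ℕ → Type*} [∀ m, NormedRing (B m)] [∀ m, NormedAlgebra L (B m)]
    {A : Type*} [Ring A] [Algebra L A] [TopologicalSpace A]
    (φ : ∀ m, B m →ₐ[L] B (m + 1)) (ι : ∀ m, B m →ₐ[L] A) : Prop where
  isTopologicalRing : IsTopologicalRing A
  isCompactTypeLimit :
    IsCompactTypeLimit L (fun m => (φ m).toLinearMap) (fun m => (ι m).toLinearMap)

/-- The topology `τ` on the `A`-module `M` is a compact type topology for which the structure map
`A × M → M` is continuous. -/
structure IsCanonicalTopology (L : Type*) [NontriviallyNormedField L]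
    (A : Type*) [Ring A] [TopologicalSpace A]
    (M : Type*) [AddCommGroup M] [Module L M] [Module A M] (τ : TopologicalSpace M) : Prop where
  isCompactType : IsCompactType L M
  continuous_smul : Continuous fun x : A × M => x.1 • x.2

/-- The subset `S` of the `A`-module `M` is a finitely generated submodule of `M` regarded as a
`B`-module through the ring homomorphism `ι : B → A`. -/
def IsFGSubmoduleVia {B A M : Type*} [Ring B] [Ring A] [AddCommGroup M] [Module A M]
    (ι : B →+* A) (S : Set M) : Prop :=
  letI : Module B M := Module.compHom M ι
  ∃ N : Submodule B M, N.FG ∧ (N : Set M) = S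

/-!
Write `M` as a quotient `f : A ^ n → M`. The point is that the quotient topology of `M` is of
compact type and that it is the only canonical topology.

*Existence.* Let `K m ⊆ (B m) ^ n` be the kernel of the restriction of `f`. Since `B m` is a
noetherian Banach algebra, `K m` is closed (`Submodule.isClosed_of_isNoetherianRing`): generators
of its closure may be moved into `K m` by a small perturbation and stay generators. So the images
of the `(B m) ^ n` in `M` are Banach spaces for their quotient norms, with injective compact
transition maps, and their limit topology is the quotient topology of `M`, because `f` is open
(`IsCompactTypeLimit.exists_quotient`). The scalar multiplication is continuous since it is so on
`A ^ n`.

*Uniqueness.* For any canonical topology, `f` is a continuous surjection between spaces of compact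
type, hence open by the open mapping theorem `IsCompactTypeLimit.isOpenQuotientMap`, a consequence
of Baire's theorem. This also shows that every finite presentation induces the canonical topology.

*Closedness and strictness.* A compact type limit is also a limit in the category of topological
spaces (`IsCompactTypeLimit.isClosed_of_preimage`): given a closed set avoiding zero, an open
lattice avoiding it is built step by step as a union of compact lattices. It follows that spaces
of compact type are Hausdorff, and that a closed subspace of such a space is of compact type again
(`IsCompactTypeLimit.exists_subspace`). For a submodule `P` of `M` the canonical topology of `M ⧸
P` is Hausdorff, so `P` is closed. For a linear map `M → N`, the subspace topology of the range is
then canonical, so by uniqueness it is the quotient topology.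
-/

/-! ### Banach spaces over a nontrivially normed field -/

section Banach

open Filter Metric

variable {L : Type*} [NontriviallyNormedField L]
  {E : Type*} [NormedAddCommGroup E] [NormedSpace L E]
  {F : Type*} [NormedAddCommGroup F] [NormedSpace L F]

/-- The iteration in the proof of the open mapping theorem: if every `y` is the image of some `x`
of controlled norm up to an error of half its norm, then it is so without error. -/
theorem ContinuousLinearMap.exists_preimage_norm_le_of_approx [CompleteSpace E] (f : E →L[L] F)
    {C : ℝ} (hC : ∀ y, ∃ x, ‖y - f x‖ ≤ 1 / 2 * ‖y‖ ∧ ‖x‖ ≤ C * ‖y‖) (y : F) :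
    ∃ x, f x = y ∧ ‖x‖ ≤ 2 * C * ‖y‖ := by
  choose g hg using hC
  let h y := y - f (g y)
  have hnle : ∀ n : ℕ, ‖h^[n] y‖ ≤ (1 / 2) ^ n * ‖y‖ := by
    intro n
    induction n with
    | zero => simp
    | succ n IH =>
      rw [Function.iterate_succ_apply', pow_succ', mul_assoc]
      exact (hg _).1.trans (by gcongr)
  rcases lt_or_ge C 0 with hC0 | hC0
  · -- for negative `C` the bound forces `F` to be zero
    have h1 := (norm_nonneg _).trans (hg y).2
    have hy : ‖y‖ = 0 := by nlinarith [norm_nonneg y]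
    exact ⟨0, by simp [norm_eq_zero.1 hy], by simp [hy]⟩
  let u n := g (h^[n] y)
  have ule : ∀ n, ‖u n‖ ≤ (1 / 2) ^ n * (C * ‖y‖) := fun n ↦ by
    calc ‖u n‖ ≤ C * ‖h^[n] y‖ := (hg _).2
      _ ≤ C * ((1 / 2) ^ n * ‖y‖) := by gcongr; exact hnle n
      _ = (1 / 2) ^ n * (C * ‖y‖) := by ring
  have sNu : Summable fun n => ‖u n‖ :=
    .of_nonneg_of_le (fun n => norm_nonneg _) ule (Summable.mul_right _ summable_geometric_two)
  have fsumeq : ∀ n : ℕ, f (∑ i ∈ Finset.range n, u i) = y - h^[n] y := by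
    intro n
    induction n with
    | zero => simp
    | succ n IH => rw [Finset.sum_range_succ, f.map_add, IH, Function.iterate_succ_apply', sub_add]
  refine ⟨tsum u, ?_, ?_⟩
  · have L₁ := (f.continuous.tendsto _).comp sNu.of_norm.hasSum.tendsto_sum_nat
    have L₂ : Tendsto (fun n => y - h^[n] y) atTop (𝓝 (y - 0)) := by
      refine tendsto_const_nhds.sub (squeeze_zero_norm hnle ?_)
      rw [← zero_mul ‖y‖]
      exact (tendsto_pow_atTop_nhds_zero_of_lt_one (by norm_num) (by norm_num)).mul_const _
    rw [sub_zero] at L₂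
    exact tendsto_nhds_unique L₁ (L₂.congr fun n => (fsumeq n).symm)
  · calc ‖tsum u‖ ≤ ∑' n, ‖u n‖ := norm_tsum_le_tsum_norm sNu
      _ ≤ ∑' n, (1 / 2 : ℝ) ^ n * (C * ‖y‖) :=
        sNu.tsum_le_tsum ule (Summable.mul_right _ summable_geometric_two)
      _ = 2 * C * ‖y‖ := by rw [tsum_mul_right, tsum_geometric_two, mul_assoc]

/-- The open mapping theorem for a map which is not assumed to be surjective: it suffices that
the image of a ball is somewhere dense. -/
theorem ContinuousLinearMap.exists_preimage_norm_le_of_interior_closure [CompleteSpace E]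
    (f : E →L[L] F) {n : ℝ} (hn : (interior (closure (f '' ball 0 n))).Nonempty) :
    ∃ C, ∀ y, ∃ x, f x = y ∧ ‖x‖ ≤ C * ‖y‖ := by
  obtain ⟨a, ha⟩ := hn
  obtain ⟨ε, εpos, H⟩ := Metric.mem_nhds_iff.1 (mem_interior_iff_mem_nhds.1 ha)
  obtain ⟨c, hc⟩ := NormedField.exists_one_lt_norm L
  have n0 : 0 ≤ n := by
    by_contra! hn
    simp [ball_eq_empty.2 hn.le] at ha
  refine ⟨_, f.exists_preimage_norm_le_of_approx (C := (ε / 2)⁻¹ * ‖c‖ * 2 * n) fun y => ?_⟩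
  rcases eq_or_ne y 0 with rfl | hy
  · exact ⟨0, by simp⟩
  obtain ⟨d, hd, ydlt, -, dinv⟩ := rescale_to_shell hc (half_pos εpos) hy
  let δ := ‖d‖ * ‖y‖ / 4
  have δpos : 0 < δ := by positivity
  have mem : a + d • y ∈ ball a ε := by
    simp [dist_eq_norm, lt_of_le_of_lt ydlt.le (half_lt_self εpos)]
  obtain ⟨_, ⟨x₁, hx₁, rfl⟩, h₁⟩ := Metric.mem_closure_iff.1 (H mem) _ δpos
  obtain ⟨_, ⟨x₂, hx₂, rfl⟩, h₂⟩ := Metric.mem_closure_iff.1 (H (mem_ball_self εpos)) _ δpos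
  rw [mem_ball, dist_eq_norm, sub_zero] at hx₁ hx₂
  have I : ‖d • y - f (x₁ - x₂)‖ ≤ 2 * δ :=
    calc
      ‖d • y - f (x₁ - x₂)‖ = ‖(a + d • y - f x₁) - (a - f x₂)‖ := by
        congr 1
        simp only [f.map_sub]
        abel
      _ ≤ ‖a + d • y - f x₁‖ + ‖a - f x₂‖ := norm_sub_le _ _
      _ ≤ 2 * δ := by rw [dist_eq_norm] at h₁ h₂; linarith
  refine ⟨d⁻¹ • (x₁ - x₂), ?_, ?_⟩
  · calc
      ‖y - f (d⁻¹ • (x₁ - x₂))‖ = ‖d⁻¹ • (d • y - f (x₁ - x₂))‖ := by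
        rw [f.map_smul, smul_sub, inv_smul_smul₀ hd]
      _ = ‖d‖⁻¹ * ‖d • y - f (x₁ - x₂)‖ := by rw [norm_smul, norm_inv]
      _ ≤ ‖d‖⁻¹ * (2 * δ) := by gcongr
      _ = 1 / 2 * ‖y‖ := by
        have : ‖d‖ ≠ 0 := by simpa using hd
        simp only [δ]
        field_simp
        norm_num
  · calc
      ‖d⁻¹ • (x₁ - x₂)‖ = ‖d‖⁻¹ * ‖x₁ - x₂‖ := by rw [norm_smul, norm_inv]
      _ ≤ (ε / 2)⁻¹ * ‖c‖ * ‖y‖ * (n + n) := by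
        gcongr
        exact (norm_sub_le _ _).trans (by gcongr)
      _ = (ε / 2)⁻¹ * ‖c‖ * 2 * n * ‖y‖ := by ring

/-- The Banach space quotient of `V` by the closed kernel of `l : V → Q`, realized in the universe
of `Q`. -/
theorem LinearMap.exists_banach_quotient {V : Type*} [NormedAddCommGroup V] [NormedSpace L V]
    [CompleteSpace V] [IsUltrametricDist V] {Q : Type uM} [AddCommGroup Q] [Module L Q]
    (l : V →ₗ[L] Q) (hl : IsClosed (LinearMap.ker l : Set V)) :
    ∃ (W : Type uM) (_ : NormedAddCommGroup W) (_ : NormedSpace L W) (π : V →ₗ[L] W)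
      (i : W →ₗ[L] Q), CompleteSpace W ∧ IsUltrametricDist W ∧ IsOpenQuotientMap π ∧
        Function.Injective i ∧ i ∘ₗ π = l := by
  have : IsClosed (LinearMap.ker l : Set V) := hl
  let e : LinearMap.range l ≃ₗ[L] V ⧸ LinearMap.ker l := l.quotKerEquivRange.symm
  let nW : NormedAddCommGroup (LinearMap.range l) := .induced _ (V ⧸ LinearMap.ker l) e e.injective
  let sW : NormedSpace L (LinearMap.range l) := .induced L _ (V ⧸ LinearMap.ker l) e
  have he : Isometry e := AddMonoidHomClass.isometry_of_norm e fun _ => rfl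
  have hV : IsUltrametricDist (V ⧸ LinearMap.ker l) := by
    refine IsUltrametricDist.isUltrametricDist_of_forall_norm_add_le_max_norm fun x y => ?_
    refine le_of_forall_pos_lt_add fun ε hε => ?_
    obtain ⟨v, rfl, hv⟩ := Submodule.Quotient.norm_mk_lt x hε
    obtain ⟨w, rfl, hw⟩ := Submodule.Quotient.norm_mk_lt y hε
    rw [← Submodule.Quotient.mk_add, ← max_add_add_right]
    exact (Submodule.Quotient.norm_mk_le _ _).trans_lt
      ((IsUltrametricDist.norm_add_le_max v w).trans_lt (max_lt_max hv hw))
  let E : LinearMap.range l ≃ᵢ V ⧸ LinearMap.ker l := ⟨e.toEquiv, he⟩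
  refine ⟨LinearMap.range l, nW, sW, l.rangeRestrict, (LinearMap.range l).subtype, ?_, ?_, ?_,
    Subtype.val_injective, rfl⟩
  · exact E.completeSpace
  · refine IsUltrametricDist.isUltrametricDist_of_forall_norm_add_le_max_norm fun x y => ?_
    change ‖e (x + y)‖ ≤ max ‖e x‖ ‖e y‖
    rw [map_add]
    exact IsUltrametricDist.norm_add_le_max _ _
  · have h1 : IsOpenQuotientMap (LinearMap.ker l).mkQ := QuotientAddGroup.isOpenQuotientMap_mk
    have h2 := E.symm.toHomeomorph.isOpenQuotientMap.comp h1
    exact h2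

end Banach

/-! ### Submodules over noetherian Banach algebras -/

section Noetherian

/-- Every submodule `N` of a finite free module over a noetherian Banach algebra is closed. By the
open mapping theorem, small perturbations of generators of the closure of `N` are generators too,
and such perturbations exist in `N`. -/
theorem Submodule.isClosed_of_isNoetherianRing (L : Type*) [NontriviallyNormedField L]
    {B : Type*} [NormedRing B] [NormedAlgebra L B] [CompleteSpace B] [IsNoetherianRing B] {n : ℕ}
    (N : Submodule B (Fin n → B)) :
    IsClosed (N : Set (Fin n → B)) := by
  set K := N.topologicalClosure
  obtain ⟨k, y, hy⟩ := Submodule.fg_iff_exists_fin_generating_family.1 (IsNoetherian.noetherian K)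
  have hyK : ∀ i, y i ∈ K := fun i => hy ▸ Submodule.subset_span ⟨i, rfl⟩
  have : CompleteSpace K := N.isClosed_topologicalClosure.completeSpace_coe
  have : CompleteSpace (K.restrictScalars L) := this
  -- the map `(b i) ↦ ∑ i, b i • z i` attached to a family of elements of `K`
  let T (z : Fin k → Fin n → B) (hz : ∀ i, z i ∈ K) : (Fin k → B) →L[L] K.restrictScalars L :=
    { toFun := fun b => ⟨∑ i, b i • z i, K.sum_mem fun i _ => K.smul_mem _ (hz i)⟩
      map_add' := fun b c => by ext1; simp [add_smul, Finset.sum_add_distrib]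
      map_smul' := fun c b => by ext1; simp [Finset.smul_sum]
      cont := by fun_prop }
  have hT : Function.Surjective (T y hyK) := fun x => by
    have hx : (x : Fin n → B) ∈ Submodule.span B (Set.range y) := by rw [hy]; exact x.2
    obtain ⟨b, hb⟩ := (Submodule.mem_span_range_iff_exists_fun B).1 hx
    exact ⟨b, Subtype.ext hb⟩
  obtain ⟨C, C0, hC⟩ := (T y hyK).exists_preimage_norm_le hT
  let δ := 1 / 2 / ((k + 1) * C)
  have hδ : 0 < δ := by positivity
  have happ : ∀ i, ∃ z ∈ N, ‖y i - z‖ < δ := fun i => by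
    obtain ⟨z, hz, hlt⟩ := Metric.mem_closure_iff.1 (hyK i) δ hδ
    exact ⟨z, hz, by rwa [← dist_eq_norm]⟩
  choose z hzN hz using happ
  have hzK : ∀ i, z i ∈ K := fun i => N.le_topologicalClosure (hzN i)
  have key := (T z hzK).exists_preimage_norm_le_of_approx (C := C) fun x => by
    obtain ⟨b, rfl, hb⟩ := hC x
    refine ⟨b, ?_, hb⟩
    have h1 : ‖T y hyK b - T z hzK b‖ = ‖∑ i, b i • (y i - z i)‖ := by
      rw [Submodule.coe_norm]
      simp [T, smul_sub]
    have h2 : ∀ i, ‖b i • (y i - z i)‖ ≤ C * ‖T y hyK b‖ * δ := fun i =>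
      calc ‖b i • (y i - z i)‖ ≤ ‖b i‖ * ‖y i - z i‖ := norm_smul_le _ _
        _ ≤ C * ‖T y hyK b‖ * δ := by
          gcongr
          · exact (norm_le_pi_norm b i).trans hb
          · exact (hz i).le
    calc _ = _ := h1
      _ ≤ ∑ i : Fin k, C * ‖T y hyK b‖ * δ := norm_sum_le_of_le _ fun i _ => h2 i
      _ = k * (C * ‖T y hyK b‖ * δ) := by simp
      _ ≤ (k + 1) * (C * ‖T y hyK b‖ * δ) := by gcongr; linarith
      _ = 1 / 2 * ‖T y hyK b‖ := by
        simp only [δ]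
        field_simp
  have hle : K ≤ N := fun x hx => by
    obtain ⟨b, hb, -⟩ := key ⟨x, hx⟩
    rw [← show ∑ i, b i • z i = x from congrArg Subtype.val hb]
    exact N.sum_mem fun i _ => N.smul_mem _ (hzN i)
  rw [← hle.antisymm N.le_topologicalClosure]
  exact N.isClosed_topologicalClosure

end Noetherian

/-! ### Locally convex inductive limits -/

section Limits

/-- The subgroup `N` is stable under the unit ball of `L`. That it be absorbing is not part of the
definition: this holds automatically for the lattices that are neighbourhoods of zero in a
compact type limit. -/
def IsLattice (L : Type*) [NontriviallyNormedField L] {E : Type*} [AddCommGroup E] [Module L E]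
    (N : AddSubgroup E) : Prop :=
  ∀ c : L, ‖c‖ ≤ 1 → ∀ x ∈ N, c • x ∈ N

variable {L : Type*} [NontriviallyNormedField L]
  {E : Type*} [AddCommGroup E] [Module L E] {F : Type*} [AddCommGroup F] [Module L F]

theorem IsLattice.map {N : AddSubgroup E} (hN : IsLattice L N) (f : E →ₗ[L] F) :
    IsLattice L (N.map (f : E →+ F)) := by
  rintro c hc _ ⟨x, hx, rfl⟩
  exact ⟨c • x, hN c hc x hx, f.map_smul c x⟩

theorem IsLattice.comap {N : AddSubgroup F} (hN : IsLattice L N) (f : E →ₗ[L] F) :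
    IsLattice L (N.comap (f : E →+ F)) := by
  intro c hc x hx
  change f (c • x) ∈ N
  rw [f.map_smul]
  exact hN c hc _ hx

theorem IsLattice.sup {N N' : AddSubgroup E} (hN : IsLattice L N) (hN' : IsLattice L N') :
    IsLattice L (N ⊔ N') := by
  intro c hc x hx
  obtain ⟨y, hy, z, hz, rfl⟩ := AddSubgroup.mem_sup.1 hx
  rw [smul_add]
  exact AddSubgroup.add_mem_sup (hN c hc y hy) (hN' c hc z hz)

variable {V : ℕ → Type*} [∀ m, NormedAddCommGroup (V m)] [∀ m, NormedSpace L (V m)]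
  [TopologicalSpace E] {φ : ∀ m, V m →ₗ[L] V (m + 1)} {j : ∀ m, V m →ₗ[L] E}

namespace IsLocallyConvexLimitTopology

theorem mem_nhds_zero (h : IsLocallyConvexLimitTopology L j) {N : AddSubgroup E}
    (hN : IsLattice L N) (ho : ∀ m, IsOpen (j m ⁻¹' (N : Set E))) : (N : Set E) ∈ 𝓝 0 :=
  h.nhds_zero.mem_of_mem ⟨hN, ho⟩

theorem continuous (h : IsLocallyConvexLimitTopology L j) (m : ℕ) : Continuous (j m) := by
  have := h.isTopologicalAddGroup
  refine continuous_of_continuousAt_zero (j m) ?_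
  rw [ContinuousAt, map_zero, h.nhds_zero.tendsto_right_iff]
  rintro N ⟨-, ho⟩
  exact (ho m).mem_nhds (by simp)

theorem exists_lattice_subset (h : IsLocallyConvexLimitTopology L j) {U : Set E} (hU : U ∈ 𝓝 0) :
    ∃ N : AddSubgroup E, IsLattice L N ∧ (N : Set E) ∈ 𝓝 0 ∧ (N : Set E) ⊆ U := by
  obtain ⟨N, hN, hNU⟩ := h.nhds_zero.mem_iff.1 hU
  exact ⟨N, hN.1, h.nhds_zero.mem_of_mem hN, hNU⟩

/-- To recognize a locally convex limit topology it suffices that small lattices exist and that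
the `j m` are continuous and jointly detect the lattices which are neighbourhoods of zero. -/
theorem of_lattices [IsTopologicalAddGroup E] (hj : ∀ m, Continuous (j m))
    (h1 : ∀ U ∈ 𝓝 (0 : E), ∃ N : AddSubgroup E,
      IsLattice L N ∧ (N : Set E) ∈ 𝓝 0 ∧ (N : Set E) ⊆ U)
    (h2 : ∀ N : AddSubgroup E, IsLattice L N → (∀ m, IsOpen (j m ⁻¹' (N : Set E))) →
      (N : Set E) ∈ 𝓝 0) : IsLocallyConvexLimitTopology L j where
  isTopologicalAddGroup := inferInstance
  nhds_zero := by
    refine ⟨fun U => ⟨fun hU => ?_, fun ⟨N, hN, hNU⟩ =>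
      Filter.mem_of_superset (h2 N hN.1 hN.2) hNU⟩⟩
    obtain ⟨N, hN, hN0, hNU⟩ := h1 U hU
    exact ⟨N, ⟨hN, fun m => (N.isOpen_of_mem_nhds hN0).preimage (hj m)⟩, hNU⟩

end IsLocallyConvexLimitTopology

/-! ### Compact type limits carry the inductive limit topology of topological spaces -/

open Metric Pointwise in
/-- The inductive step for the construction of open lattices in a compact type limit: a compact
lattice `C` whose image avoids a closed set can be enlarged to a compact lattice in the next Banach
space which still avoids that set, and whose preimage is open. -/
theorem exists_compact_lattice_disjoint {V W : Type*} [NormedAddCommGroup V] [NormedSpace L V]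
    [IsUltrametricDist V] [NormedAddCommGroup W] [NormedSpace L W]
    {φ : V →ₗ[L] W} (hφ : IsCompactOperator φ) {C : AddSubgroup V} (hC : IsCompact (C : Set V))
    (hCl : IsLattice L C) {T : Set W} (hT : IsClosed T) (hCT : Disjoint (φ '' C) T) :
    ∃ D : AddSubgroup W, IsCompact (D : Set W) ∧ IsLattice L D ∧ Disjoint (D : Set W) T ∧
      (∀ x ∈ C, φ x ∈ D) ∧ φ ⁻¹' D ∈ 𝓝 0 := by
  have hc : Continuous φ := hφ.continuous
  obtain ⟨δ, hδ, hδT⟩ := (hC.image hc).exists_thickening_subset_open hT.isOpen_compl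
    (Set.disjoint_left.1 hCT)
  obtain ⟨K, hK, hKφ⟩ := hφ.image_ball_subset_compact 1
  have hcl : φ ⁻¹' closedBall 0 (δ / 2) ∈ 𝓝 0 :=
    hc.continuousAt.preimage_mem_nhds (by rw [map_zero]; exact closedBall_mem_nhds _ (half_pos hδ))
  obtain ⟨η, hη, hηφ⟩ := Metric.mem_nhds_iff.1 hcl
  have hε : 0 < min 1 η := lt_min one_pos hη
  let U : AddSubgroup V := (IsUltrametricDist.ball_openAddSubgroup V hε).toAddSubgroup
  have hUmem : ∀ x, x ∈ U ↔ ‖x‖ < min 1 η := fun x => mem_ball_zero_iff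
  have hUl : IsLattice L U := fun c hc x hx => by
    rw [hUmem] at hx ⊢
    rw [norm_smul]
    exact (mul_le_of_le_one_left (norm_nonneg _) hc).trans_lt hx
  let H : AddSubgroup W := (U.map (φ : V →+ W)).topologicalClosure
  have hUK : (U.map (φ : V →+ W) : Set W) ⊆ K := by
    rintro _ ⟨x, hx, rfl⟩
    exact hKφ ⟨x, mem_ball_zero_iff.2 (((hUmem x).1 hx).trans_le (min_le_left _ _)), rfl⟩
  have hH : IsCompact (H : Set W) :=
    hK.of_isClosed_subset isClosed_closure (closure_minimal hUK hK.isClosed)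
  have hHb : (H : Set W) ⊆ closedBall 0 (δ / 2) := by
    refine closure_minimal ?_ isClosed_closedBall
    rintro _ ⟨x, hx, rfl⟩
    exact hηφ (mem_ball_zero_iff.2 (((hUmem x).1 hx).trans_le (min_le_right _ _)))
  have hHl : IsLattice L H := fun c hc x hx =>
    map_mem_closure (continuous_const_smul c) hx fun y hy => hUl.map φ c hc y hy
  refine ⟨C.map (φ : V →+ W) ⊔ H, ?_, (hCl.map φ).sup hHl, ?_, ?_, ?_⟩
  · have : ((C.map (φ : V →+ W) ⊔ H : AddSubgroup W) : Set W) = φ '' C + (H : Set W) :=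
      AddSubgroup.add_normal _ _
    rw [this]
    exact (hC.image hc).add hH
  · refine Set.disjoint_left.2 fun x hx => hδT ?_
    obtain ⟨y, hy, z, hz, rfl⟩ := AddSubgroup.mem_sup.1 hx
    refine mem_thickening_iff.2 ⟨y, hy, ?_⟩
    have := mem_closedBall_zero_iff.1 (hHb hz)
    rw [dist_eq_norm, add_sub_cancel_left]
    linarith
  · exact fun x hx => AddSubgroup.mem_sup_left ⟨x, hx, rfl⟩
  · refine Filter.mem_of_superset (ball_mem_nhds 0 hε) fun x hx => AddSubgroup.mem_sup_right ?_
    exact subset_closure ⟨x, hx, rfl⟩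

namespace IsCompactTypeLimit

theorem continuous_transition (h : IsCompactTypeLimit L φ j) (m : ℕ) : Continuous (φ m) :=
  (h.transition_compact m).continuous

theorem map_comp_apply (h : IsCompactTypeLimit L φ j) (m : ℕ) (x : V m) :
    j (m + 1) (φ m x) = j m x :=
  LinearMap.congr_fun (h.map_comp m) x

theorem exists_transition (h : IsCompactTypeLimit L φ j) {m k : ℕ} (hmk : m ≤ k) :
    ∃ t : V m →L[L] V k, ∀ x, j k (t x) = j m x := by
  induction k, hmk using Nat.le_induction with
  | base => exact ⟨.id L _, fun _ => rfl⟩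
  | succ k _ ih =>
    obtain ⟨t, ht⟩ := ih
    refine ⟨ContinuousLinearMap.comp ⟨φ k, h.continuous_transition k⟩ t, fun x => ?_⟩
    rw [← ht x]
    exact h.map_comp_apply k (t x)

/-- A set which does not contain zero and is closed in every `V m` is avoided by an open lattice: the
union of a sequence of compact lattices obtained from `exists_compact_lattice_disjoint`. -/
theorem exists_lattice_disjoint (h : IsCompactTypeLimit L φ j) {S : Set E}
    (hS : ∀ m, IsClosed (j m ⁻¹' S)) (h0 : (0 : E) ∉ S) :
    ∃ N : AddSubgroup E, IsLattice L N ∧ (N : Set E) ∈ 𝓝 0 ∧ Disjoint (N : Set E) S := by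
  have := h.isUltrametricDist
  let P (m : ℕ) (C : AddSubgroup (V m)) : Prop :=
    IsCompact (C : Set (V m)) ∧ IsLattice L C ∧ Disjoint (C : Set (V m)) (j m ⁻¹' S)
  have hP0 : P 0 ⊥ := by
    refine ⟨by simp, fun c _ x hx => ?_, by simpa using h0⟩
    rw [AddSubgroup.mem_bot.1 hx, smul_zero]
    exact AddSubgroup.zero_mem _
  have step : ∀ m (C : {C // P m C}), ∃ D : {D // P (m + 1) D},
      (∀ x ∈ C.1, φ m x ∈ D.1) ∧ φ m ⁻¹' (D.1 : Set (V (m + 1))) ∈ 𝓝 0 := by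
    rintro m ⟨C, hC, hCl, hCS⟩
    have hdisj : Disjoint (φ m '' C) (j (m + 1) ⁻¹' S) := by
      refine Set.disjoint_left.2 ?_
      rintro _ ⟨x, hx, rfl⟩ hxS
      rw [Set.mem_preimage, h.map_comp_apply] at hxS
      exact Set.disjoint_left.1 hCS hx hxS
    obtain ⟨D, hD, hDl, hDS, h1, h2⟩ :=
      exists_compact_lattice_disjoint (h.transition_compact m) hC hCl (hS (m + 1)) hdisj
    exact ⟨⟨D, hD, hDl, hDS⟩, h1, h2⟩
  choose next hnext1 hnext2 using step
  let D (m : ℕ) : {C // P m C} := Nat.rec ⟨⊥, hP0⟩ next m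
  have hmono : Monotone fun m => (D m).1.map (j m : V m →+ E) := by
    refine monotone_nat_of_le_succ fun m => ?_
    rintro _ ⟨x, hx, rfl⟩
    exact ⟨φ m x, hnext1 m (D m) x hx, h.map_comp_apply m x⟩
  let N : AddSubgroup E := ⨆ m, (D m).1.map (j m : V m →+ E)
  have hN : ∀ x, x ∈ N ↔ ∃ m, ∃ d ∈ (D m).1, j m d = x := fun x =>
    AddSubgroup.mem_iSup_of_directed hmono.directed_le
  have hNl : IsLattice L N := fun c hc x hx => by
    obtain ⟨m, d, hd, rfl⟩ := (hN x).1 hx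
    exact (hN _).2 ⟨m, c • d, (D m).2.2.1 c hc d hd, (j m).map_smul c d⟩
  refine ⟨N, hNl, h.topology.mem_nhds_zero hNl fun m => ?_, Set.disjoint_left.2 fun x hx => ?_⟩
  · refine (N.comap (j m : V m →+ E)).isOpen_of_mem_nhds (g := 0) ?_
    refine Filter.mem_of_superset (hnext2 m (D m)) fun x hx => ?_
    exact (hN _).2 ⟨m + 1, φ m x, hx, h.map_comp_apply m x⟩
  · obtain ⟨m, d, hd, rfl⟩ := (hN x).1 hx
    exact Set.disjoint_left.1 (D m).2.2.2 hd

/-- A compact type limit is an inductive limit in the category of topological spaces as well. -/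
theorem isClosed_of_preimage (h : IsCompactTypeLimit L φ j) {S : Set E}
    (hS : ∀ m, IsClosed (j m ⁻¹' S)) : IsClosed S := by
  have := h.topology.isTopologicalAddGroup
  refine isOpen_compl_iff.1 (isOpen_iff_mem_nhds.2 fun x hx => ?_)
  have hcl : ∀ m, IsClosed (j m ⁻¹' ((· + x) ⁻¹' S)) := fun m => by
    obtain ⟨k, y, rfl⟩ := h.exists_eq x
    obtain ⟨s, hs⟩ := h.exists_transition (le_max_left m k)
    obtain ⟨t, ht⟩ := h.exists_transition (le_max_right m k)
    have : j m ⁻¹' ((· + j k y) ⁻¹' S) = (fun v => s v + t y) ⁻¹' (j (max m k) ⁻¹' S) := by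
      ext v
      simp [hs, ht]
    rw [this]
    exact (hS _).preimage (by fun_prop)
  obtain ⟨N, -, hN0, hNS⟩ := h.exists_lattice_disjoint hcl (by simpa using hx)
  rw [← map_add_right_nhds_zero x]
  refine Filter.mem_map.2 (Filter.mem_of_superset hN0 fun y hy => ?_)
  exact Set.disjoint_left.1 hNS hy

theorem t2Space (h : IsCompactTypeLimit L φ j) : T2Space E := by
  have := h.topology.isTopologicalAddGroup
  have : T1Space E := ⟨fun x => h.isClosed_of_preimage fun m =>
    (Set.subsingleton_singleton.preimage (h.injective m)).isClosed⟩
  infer_instance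

/-! ### Subspaces, products and quotients -/

/-- A closed subspace of a compact type space is of compact type. -/
theorem exists_subspace {E : Type*} [AddCommGroup E] [Module L E] [TopologicalSpace E]
    {V : ℕ → Type uN} [∀ m, NormedAddCommGroup (V m)] [∀ m, NormedSpace L (V m)]
    {φ : ∀ m, V m →ₗ[L] V (m + 1)} {j : ∀ m, V m →ₗ[L] E} (h : IsCompactTypeLimit L φ j)
    (P : Submodule L E) (hP : IsClosed (P : Set E)) :
    ∃ (W : ℕ → Type uN) (_ : ∀ m, NormedAddCommGroup (W m)) (_ : ∀ m, NormedSpace L (W m))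
      (ψ : ∀ m, W m →ₗ[L] W (m + 1)) (i : ∀ m, W m →ₗ[L] P), IsCompactTypeLimit L ψ i := by
  have hadd := h.topology.isTopologicalAddGroup
  have hult := h.isUltrametricDist
  have hcomplete := h.completeSpace
  have hW : ∀ m, IsClosed (P.comap (j m) : Set (V m)) := fun m =>
    hP.preimage (h.topology.continuous m)
  have hφ : ∀ m, ∀ x ∈ P.comap (j m), φ m x ∈ P.comap (j (m + 1)) := fun m x hx => by
    rw [Submodule.mem_comap, h.map_comp_apply]
    exact hx
  have hj : ∀ m, ∀ x ∈ P.comap (j m), j m x ∈ P := fun m x hx => hx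
  refine ⟨fun m => P.comap (j m), fun m => inferInstance, fun m => inferInstance,
    fun m => (φ m).restrict (hφ m), fun m => (j m).restrict (hj m), ?_⟩
  refine ⟨fun m => inferInstance, fun m => (hW m).completeSpace_coe, fun m x y hxy => ?_,
    fun m => ?_, fun m => ?_, fun m x y hxy => ?_, fun v => ?_, ?_⟩
  · exact Subtype.ext (h.transition_injective m (congrArg Subtype.val hxy))
  · have h1 : IsCompactOperator (φ m ∘ Subtype.val : P.comap (j m) → V (m + 1)) :=
      (h.transition_compact m).comp_clm (P.comap (j m)).subtypeL
    exact h1.codRestrict (fun x => hφ m x x.2) (hW (m + 1))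
  · ext x
    exact h.map_comp_apply m x
  · exact Subtype.ext (h.injective m (congrArg Subtype.val hxy))
  · obtain ⟨m, x, hx⟩ := h.exists_eq v
    exact ⟨m, ⟨x, by rw [Submodule.mem_comap, hx]; exact v.2⟩, Subtype.ext hx⟩
  · have : IsTopologicalAddGroup P := inferInstance
    refine .of_lattices (fun m => ?_) (fun U hU => ?_) fun N hN ho => ?_
    · exact ((h.topology.continuous m).comp continuous_subtype_val).subtype_mk _
    · obtain ⟨U', hU', hUU⟩ := mem_nhdsWithin_iff_exists_mem_nhds_inter.1
        (mem_nhds_subtype_iff_nhdsWithin.1 hU)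
      obtain ⟨N, hN, hN0, hNU⟩ := h.topology.exists_lattice_subset hU'
      refine ⟨N.comap (P.subtype : P →+ E), hN.comap P.subtype, ?_, fun x hx => ?_⟩
      · exact continuous_subtype_val.continuousAt.preimage_mem_nhds hN0
      · obtain ⟨y, hy, hyx⟩ := hUU ⟨hNU hx, x.2⟩
        rwa [← Subtype.ext hyx]
    · -- the complement of `N` in `P` is closed in each step of the limit, hence avoids a lattice
      have hS : ∀ m, IsClosed (j m ⁻¹' (Subtype.val '' (N : Set P)ᶜ)) := fun m => by
        have : j m ⁻¹' (Subtype.val '' (N : Set P)ᶜ) =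
            Subtype.val '' ((j m).restrict (hj m) ⁻¹' (N : Set P))ᶜ := by
          ext x
          constructor
          · rintro ⟨y, hy, hyx⟩
            have hx : j m x ∈ P := hyx ▸ y.2
            exact ⟨⟨x, hx⟩, fun hxN => hy (by rwa [show y = ⟨j m x, hx⟩ from Subtype.ext hyx]), rfl⟩
          · rintro ⟨y, hy, rfl⟩
            exact ⟨_, hy, rfl⟩
        rw [this]
        exact (hW m).isClosedEmbedding_subtypeVal.isClosedMap _ (ho m).isClosed_compl
      obtain ⟨N', -, hN0, hdisj⟩ := h.exists_lattice_disjoint hS (by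
        rintro ⟨y, hy, hy0⟩
        exact hy (by rw [show y = 0 from Subtype.ext hy0]; exact N.zero_mem))
      refine Filter.mem_of_superset (continuous_subtype_val.continuousAt.preimage_mem_nhds hN0)
        fun x hx => ?_
      by_contra hxN
      exact Set.disjoint_left.1 hdisj hx ⟨x, hxN, rfl⟩

/-- A finite power of a compact type limit is the limit of the powers. -/
theorem pi (h : IsCompactTypeLimit L φ j) (n : ℕ) :
    IsCompactTypeLimit L (fun m => (φ m).compLeft (Fin n)) (fun m => (j m).compLeft (Fin n)) := by
  have hadd := h.topology.isTopologicalAddGroup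
  have hult := h.isUltrametricDist
  have hcomplete := h.completeSpace
  refine ⟨fun m => inferInstance, fun m => inferInstance, fun m => ?_, fun m => ?_, fun m => ?_,
    fun m => ?_, fun v => ?_, .of_lattices (fun m => ?_) (fun U hU => ?_) fun N hN ho => ?_⟩
  · exact (h.transition_injective m).comp_left
  · obtain ⟨K, hK, hKφ⟩ := h.transition_compact m
    refine ⟨Set.univ.pi fun _ => K, isCompact_univ_pi fun _ => hK, ?_⟩
    have : Set.univ.pi (fun _ : Fin n => φ m ⁻¹' K) ∈ 𝓝 (0 : Fin n → V m) :=
      set_pi_mem_nhds Set.finite_univ fun _ _ => hKφ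
    exact this
  · exact LinearMap.ext fun x => funext fun i => h.map_comp_apply m (x i)
  · exact (h.injective m).comp_left
  · choose k x hx using fun i => h.exists_eq (v i)
    have hk : ∀ i, k i ≤ Finset.univ.sup k := fun i => Finset.le_sup (Finset.mem_univ i)
    choose t ht using fun i => h.exists_transition (hk i)
    exact ⟨_, fun i => t i (x i), funext fun i => (ht i _).trans (hx i)⟩
  · exact continuous_pi fun i => (h.topology.continuous m).comp (continuous_apply i)
  · rw [nhds_pi] at hU
    obtain ⟨I, -, s, hs, hsU⟩ := Filter.mem_pi.1 hU
    choose N hN hN0 hNs using fun i => h.topology.exists_lattice_subset (hs i)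
    refine ⟨AddSubgroup.pi Set.univ N, fun c hc x hx i hi => hN i c hc _ (hx i hi), ?_,
      fun x hx => hsU fun i _ => hNs i (hx i trivial)⟩
    exact set_pi_mem_nhds Set.finite_univ fun i _ => hN0 i
  · have hN0 : ∀ i,
        (N.comap (LinearMap.single L (fun _ => E) i : E →+ (Fin n → E)) : Set E) ∈ 𝓝 0 :=
      fun i => h.topology.mem_nhds_zero (hN.comap (LinearMap.single L (fun _ => E) i)) fun m => by
        have hc : Continuous fun x : V m => (Pi.single i x : Fin n → V m) :=
          continuous_single (A := fun _ => V m) i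
        convert (ho m).preimage hc using 1
        ext x
        have : (j m).compLeft (Fin n) (Pi.single i x) = Pi.single i (j m x) := by
          ext k
          rcases eq_or_ne k i with rfl | hk
          · simp
          · simp [hk]
        change Pi.single i (j m x) ∈ N ↔ (j m).compLeft (Fin n) (Pi.single i x) ∈ N
        rw [this]
    refine Filter.mem_of_superset (set_pi_mem_nhds Set.finite_univ fun i _ => hN0 i) fun x hx => ?_
    rw [← Finset.univ_sum_single x]
    exact N.sum_mem fun i _ => hx i trivial

/-- A quotient of a compact type limit by a subspace whose preimages in the Banach spaces `V m` are
closed is the limit of the corresponding quotients of the `V m`. -/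
theorem exists_quotient (h : IsCompactTypeLimit L φ j) {Q : Type uM} [AddCommGroup Q] [Module L Q]
    [TopologicalSpace Q] [IsTopologicalAddGroup Q] (q : E →ₗ[L] Q) (hq : IsOpenQuotientMap q)
    (hker : ∀ m, IsClosed (LinearMap.ker (q ∘ₗ j m) : Set (V m))) :
    ∃ (W : ℕ → Type uM) (_ : ∀ m, NormedAddCommGroup (W m)) (_ : ∀ m, NormedSpace L (W m))
      (ψ : ∀ m, W m →ₗ[L] W (m + 1)) (i : ∀ m, W m →ₗ[L] Q), IsCompactTypeLimit L ψ i ∧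
        ∀ m, Set.range (i m) = Set.range (q ∘ₗ j m) := by
  have hult := h.isUltrametricDist
  have hcomplete := h.completeSpace
  choose W nW sW π i hWc hWu hπ hi hiπ using fun m => (q ∘ₗ j m).exists_banach_quotient (hker m)
  have hiπ' : ∀ m x, i m (π m x) = q (j m x) := fun m x => LinearMap.congr_fun (hiπ m) x
  have hle : ∀ m w, i m w ∈ LinearMap.range (i (m + 1)) := fun m w => by
    obtain ⟨x, rfl⟩ := (hπ m).surjective w
    exact ⟨π (m + 1) (φ m x), by rw [hiπ', hiπ', h.map_comp_apply]⟩
  let ψ (m : ℕ) : W m →ₗ[L] W (m + 1) :=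
    (LinearEquiv.ofInjective (i (m + 1)) (hi (m + 1))).symm ∘ₗ (i m).codRestrict _ (hle m)
  have hψ : ∀ m w, i (m + 1) (ψ m w) = i m w := fun m w =>
    congrArg Subtype.val ((LinearEquiv.ofInjective (i (m + 1)) (hi (m + 1))).apply_symm_apply
      ((i m).codRestrict _ (hle m) w))
  have hψπ : ∀ m x, ψ m (π m x) = π (m + 1) (φ m x) := fun m x =>
    hi (m + 1) (by rw [hψ, hiπ', hiπ', h.map_comp_apply])
  refine ⟨W, nW, sW, ψ, i, ⟨hWu, hWc, fun m x y hxy => hi m ?_, fun m => ?_, fun m => ?_, hi,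
    fun v => ?_, .of_lattices (fun m => ?_) (fun U hU => ?_) fun N hN ho => ?_⟩, fun m => ?_⟩
  · rw [← hψ m x, hxy, hψ]
  · obtain ⟨K, hK, hKφ⟩ := (h.transition_compact m).continuous_comp (hπ (m + 1)).continuous
    refine ⟨K, hK, ?_⟩
    have := (hπ m).isOpenMap.image_mem_nhds hKφ
    rw [map_zero] at this
    refine Filter.mem_of_superset this ?_
    rintro _ ⟨x, hx, rfl⟩
    rw [Set.mem_preimage, hψπ]
    exact hx
  · ext w
    exact hψ m w
  · obtain ⟨e, rfl⟩ := hq.surjective v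
    obtain ⟨m, x, rfl⟩ := h.exists_eq e
    exact ⟨m, π m x, hiπ' m x⟩
  · rw [← (hπ m).continuous_comp_iff]
    have : i m ∘ π m = q ∘ j m := funext (hiπ' m)
    rw [this]
    exact hq.continuous.comp (h.topology.continuous m)
  · have : q ⁻¹' U ∈ 𝓝 0 := hq.continuous.continuousAt.preimage_mem_nhds (by rwa [map_zero])
    obtain ⟨N, hN, hN0, hNU⟩ := h.topology.exists_lattice_subset this
    refine ⟨N.map (q : E →+ Q), hN.map q, ?_, ?_⟩
    · have := hq.isOpenMap.image_mem_nhds hN0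
      rwa [map_zero] at this
    · rintro _ ⟨x, hx, rfl⟩
      exact hNU hx
  · have : (N.comap (q : E →+ Q) : Set E) ∈ 𝓝 0 := by
      refine h.topology.mem_nhds_zero (hN.comap q) fun m => ?_
      convert (ho m).preimage (hπ m).continuous using 1
      ext x
      simp [hiπ']
    have := hq.isOpenMap.image_mem_nhds this
    rw [map_zero] at this
    exact Filter.mem_of_superset this (Set.image_preimage_subset _ _)
  · rw [← hiπ m, LinearMap.coe_comp, (hπ m).surjective.range_comp]

/-! ### The open mapping theorem -/

/-- A continuous linear surjection between compact type spaces is open. For each `k`, the Banach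
space `W k` is the union over `m` of the images of the fibre products of `V m` and `W k` over `F`.
By Baire's theorem one of these images is somewhere dense in `W k`, and the open mapping theorem
applies to the corresponding projection. -/
theorem isOpenQuotientMap [TopologicalSpace F] {W : ℕ → Type*} [∀ m, NormedAddCommGroup (W m)]
    [∀ m, NormedSpace L (W m)] {ψ : ∀ m, W m →ₗ[L] W (m + 1)} {i : ∀ m, W m →ₗ[L] F}
    (h : IsCompactTypeLimit L φ j) (h' : IsCompactTypeLimit L ψ i) (q : E →ₗ[L] F)
    (hq : Continuous q) (hs : Function.Surjective q) : IsOpenQuotientMap q := by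
  have := h.topology.isTopologicalAddGroup
  have := h'.topology.isTopologicalAddGroup
  have := h'.t2Space
  have := h.completeSpace
  have := h'.completeSpace
  refine ⟨hs, hq, ?_⟩
  suffices hN : ∀ N : AddSubgroup E, IsLattice L N → (N : Set E) ∈ 𝓝 0 →
      (N.map (q : E →+ F) : Set F) ∈ 𝓝 0 by
    refine (IsTopologicalAddGroup.isOpenMap_iff_nhds_zero (f := (q : E →+ F))).2 fun U hU => ?_
    obtain ⟨N, hNl, hN0, hNU⟩ := h.topology.exists_lattice_subset (Filter.mem_map.1 hU)
    refine Filter.mem_of_superset (hN N hNl hN0) ?_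
    rintro _ ⟨x, hx, rfl⟩
    exact hNU hx
  intro N hNl hN0
  refine h'.topology.mem_nhds_zero (hNl.map q) fun k => ?_
  refine ((N.map (q : E →+ F)).comap (i k : W k →+ F)).isOpen_of_mem_nhds (g := 0) ?_
  -- the fibre products of the `V m` and `W k` over `F`
  let d (m : ℕ) : V m × W k →L[L] F :=
    ⟨(q ∘ₗ j m).coprod (-(i k)), by
      have h1 := hq.comp (h.topology.continuous m)
      have h2 := h'.topology.continuous k
      exact (h1.comp continuous_fst).add (h2.comp continuous_snd).neg⟩
  let G (m : ℕ) : Submodule L (V m × W k) := (d m).ker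
  have hG : ∀ m x, x ∈ G m ↔ q (j m x.1) = i k x.2 := fun m x => by
    change q (j m x.1) + -(i k x.2) = 0 ↔ _
    rw [add_neg_eq_zero]
  have hGc : ∀ m, CompleteSpace (G m) := fun m => (d m).isClosed_ker.completeSpace_coe
  let pr (m : ℕ) : G m →L[L] W k := (ContinuousLinearMap.snd L (V m) (W k)).comp (G m).subtypeL
  have hcover : ⋃ a : ℕ × ℕ, closure (pr a.1 '' Metric.ball 0 a.2) = Set.univ := by
    refine Set.eq_univ_of_forall fun w => ?_
    obtain ⟨e, he⟩ := hs (i k w)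
    obtain ⟨m, v, rfl⟩ := h.exists_eq e
    obtain ⟨n, hn⟩ := exists_nat_gt ‖(⟨(v, w), (hG m (v, w)).2 he⟩ : G m)‖
    exact Set.mem_iUnion.2 ⟨(m, n), subset_closure ⟨_, mem_ball_zero_iff.2 hn, rfl⟩⟩
  obtain ⟨⟨m, n⟩, hmn⟩ := nonempty_interior_of_iUnion_of_closed (fun _ => isClosed_closure) hcover
  obtain ⟨C, hC⟩ := (pr m).exists_preimage_norm_le_of_interior_closure hmn
  have hNm : j m ⁻¹' N ∈ 𝓝 0 :=
    (h.topology.continuous m).continuousAt.preimage_mem_nhds (by rwa [map_zero])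
  obtain ⟨ε, hε, hεN⟩ := Metric.mem_nhds_iff.1 hNm
  have hlim : Filter.Tendsto (fun w : W k => C * ‖w‖) (𝓝 0) (𝓝 0) := by
    have : Continuous fun w : W k => C * ‖w‖ := by fun_prop
    simpa using this.tendsto 0
  filter_upwards [hlim (Iio_mem_nhds hε)] with w hw
  obtain ⟨x, rfl, hxC⟩ := hC w
  refine ⟨j m x.1.1, hεN (mem_ball_zero_iff.2 ?_), (hG m x.1).1 x.2⟩
  exact (norm_fst_le x.1).trans_lt (hxC.trans_lt hw)

end IsCompactTypeLimit

end Limits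

/-! ### Finitely generated modules over compact type algebras -/

section Modules

section FreeModules

variable {A : Type*} [Ring A] {M : Type*} [AddCommGroup M] [Module A M]

theorem isOpenQuotientMap_of_coinduced {E : Type*} [AddCommGroup E] [Module A E]
    [TopologicalSpace E] [IsTopologicalAddGroup E] [τ : TopologicalSpace M] (f : E →ₗ[A] M)
    (hf : Function.Surjective f) (hτ : τ = .coinduced f inferInstance) : IsOpenQuotientMap f :=
  AddMonoidHom.isOpenQuotientMap_of_isQuotientMap (φ := f) ⟨⟨hτ⟩, hf⟩

/-- The image of a topological group under an open quotient homomorphism is a topological group. -/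
theorem IsOpenQuotientMap.isTopologicalAddGroup {E : Type*} [AddCommGroup E] [Module A E]
    [TopologicalSpace E] [IsTopologicalAddGroup E] [TopologicalSpace M] {f : E →ₗ[A] M}
    (hf : IsOpenQuotientMap f) : IsTopologicalAddGroup M where
  continuous_add := by
    rw [← (hf.prodMap hf).continuous_comp_iff]
    have : (fun p : M × M => p.1 + p.2) ∘ Prod.map f f = f ∘ fun p => p.1 + p.2 := by
      ext p
      simp
    rw [this]
    exact hf.continuous.comp continuous_add
  continuous_neg := by
    rw [← hf.continuous_comp_iff]
    have : (fun x : M => -x) ∘ f = f ∘ fun x => -x := by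
      ext x
      simp
    rw [this]
    exact hf.continuous.comp continuous_neg

/-- The restriction to `B ^ n` of a linear map `f : A ^ n → M`, as a map of `B`-modules. -/
theorem LinearMap.exists_compHom_restriction {B : Type*} [Ring B] (ι : B →+* A)
    {n : ℕ} (f : (Fin n → A) →ₗ[A] M) :
    letI : Module B M := Module.compHom M ι
    ∃ g : (Fin n → B) →ₗ[B] M, ∀ x, g x = f (ι ∘ x) := by
  let : Module B M := Module.compHom M ι
  refine ⟨⟨⟨fun x => f (ι ∘ x), fun x y => ?_⟩, fun b x => ?_⟩, fun x => rfl⟩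
  · rw [← map_add]
    exact congrArg f (funext fun i => by simp)
  · change _ = ι b • f (ι ∘ x)
    rw [← map_smul]
    exact congrArg f (funext fun i => by simp)

end FreeModules

variable {L : Type*} [NontriviallyNormedField L]
  {A : Type*} [Ring A] [TopologicalSpace A]
  {M : Type uM} [AddCommGroup M] [Module A M] [Module L M]

theorem IsCompactType.isTopologicalAddGroup [TopologicalSpace M] (h : IsCompactType L M) :
    IsTopologicalAddGroup M := by
  obtain ⟨V, _, _, φ, j, h⟩ := h
  exact h.topology.isTopologicalAddGroup

theorem IsCompactType.t2Space [TopologicalSpace M] (h : IsCompactType L M) : T2Space M := by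
  obtain ⟨V, _, _, φ, j, h⟩ := h
  exact h.t2Space

/-- Linear maps from finite free modules are continuous for canonical topologies. -/
theorem IsCanonicalTopology.continuous_of_pi [τ : TopologicalSpace M]
    (hM : IsCanonicalTopology L A M τ) {n : ℕ} (f : (Fin n → A) →ₗ[A] M) : Continuous f := by
  have := hM.isCompactType.isTopologicalAddGroup
  have hf : (f : (Fin n → A) → M) = fun x => ∑ i, x i • f (Pi.single i 1) :=
    funext fun x => by
      conv_lhs => rw [← Finset.univ_sum_single x, map_sum]
      refine Finset.sum_congr rfl fun i _ => ?_
      rw [← map_smul, ← Pi.single_smul, smul_eq_mul, mul_one]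
  rw [hf]
  refine continuous_finsetSum _ fun i _ => ?_
  have hi : Continuous fun x : Fin n → A => (x i, f (Pi.single i 1)) :=
    (continuous_apply i).prodMk continuous_const
  exact hM.continuous_smul.comp hi

variable [Algebra L A] [IsScalarTower L A M]
  {B : ℕ → Type*} [∀ m, NormedRing (B m)] [∀ m, NormedAlgebra L (B m)]
  {φ : ∀ m, B m →ₐ[L] B (m + 1)} {ι : ∀ m, B m →ₐ[L] A}

namespace IsCompactTypeAlgebra

/-- The quotient topology of a finite free module is canonical, and the Banach spaces of which it is
the limit can be chosen as the images of the `B m ^ n`. -/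
theorem isCanonicalTopology_of_isOpenQuotientMap [∀ m, IsNoetherianRing (B m)]
    (hA : IsCompactTypeAlgebra L φ ι) [τ : TopologicalSpace M] {n : ℕ} (f : (Fin n → A) →ₗ[A] M)
    (hf : IsOpenQuotientMap f) :
    IsCanonicalTopology L A M τ ∧
      ∃ (V : ℕ → Type uM) (_ : ∀ m, NormedAddCommGroup (V m)) (_ : ∀ m, NormedSpace L (V m))
        (ψ : ∀ m, V m →ₗ[L] V (m + 1)) (j : ∀ m, V m →ₗ[L] M),
        IsCompactTypeLimit L ψ j ∧
        ∀ m, IsFGSubmoduleVia (ι m : B m →+* A) (Set.range (j m)) := by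
  have := hA.isTopologicalRing
  have := hA.isCompactTypeLimit.completeSpace
  have hMg := hf.isTopologicalAddGroup
  have hpi := hA.isCompactTypeLimit.pi n
  obtain ⟨V, nV, sV, ψ, j, hV, hr⟩ := hpi.exists_quotient (f.restrictScalars L) hf fun m => by
    let : Module (B m) M := Module.compHom M (ι m : B m →+* A)
    obtain ⟨g, hg⟩ := LinearMap.exists_compHom_restriction (ι m : B m →+* A) f
    have hk : (LinearMap.ker (f.restrictScalars L ∘ₗ (ι m).toLinearMap.compLeft (Fin n)) :
        Set (Fin n → B m)) = LinearMap.ker g := Set.ext fun x => by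
      change f (ι m ∘ x) = 0 ↔ g x = 0
      rw [hg]
      rfl
    rw [hk]
    exact (LinearMap.ker g).isClosed_of_isNoetherianRing L
  refine ⟨⟨⟨V, nV, sV, ψ, j, hV⟩, ?_⟩, V, nV, sV, ψ, j, hV, fun m => ?_⟩
  · rw [← (IsOpenQuotientMap.id.prodMap hf).continuous_comp_iff]
    have : (fun x : A × M => x.1 • x.2) ∘ Prod.map id f = f ∘ fun x => x.1 • x.2 := by
      ext x
      simp
    rw [this]
    exact hf.continuous.comp (by fun_prop)
  · let : Module (B m) M := Module.compHom M (ι m : B m →+* A)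
    obtain ⟨g, hg⟩ := LinearMap.exists_compHom_restriction (ι m : B m →+* A) f
    refine ⟨LinearMap.range g, Module.Finite.fg_top.map g |> (LinearMap.range_eq_map g ▸ ·), ?_⟩
    rw [hr, LinearMap.coe_range]
    exact congrArg Set.range (funext hg)

/-- By the open mapping theorem, any canonical topology is a quotient topology. -/
theorem isOpenQuotientMap (hA : IsCompactTypeAlgebra L φ ι) [τ : TopologicalSpace M]
    (hM : IsCanonicalTopology L A M τ) {n : ℕ} (f : (Fin n → A) →ₗ[A] M)
    (hf : Function.Surjective f) : IsOpenQuotientMap f := by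
  obtain ⟨V, _, _, ψ, j, hV⟩ := hM.isCompactType
  exact (hA.isCompactTypeLimit.pi n).isOpenQuotientMap hV (f.restrictScalars L)
    (hM.continuous_of_pi f) hf

/-- All submodules `P` of `M` are closed, since the canonical topology of `M ⧸ P` is Hausdorff. -/
theorem isClosed_submodule [∀ m, IsNoetherianRing (B m)] [Module.Finite A M]
    (hA : IsCompactTypeAlgebra L φ ι) [τ : TopologicalSpace M] (hM : IsCanonicalTopology L A M τ)
    (P : Submodule A M) : IsClosed (P : Set M) := by
  have := hA.isTopologicalRing
  obtain ⟨n, f, hf⟩ := Module.Finite.exists_fin' A M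
  have hq : IsOpenQuotientMap f := hA.isOpenQuotientMap hM f hf
  let : TopologicalSpace (M ⧸ P) := .coinduced (P.mkQ ∘ₗ f) inferInstance
  have hq' : IsOpenQuotientMap (P.mkQ ∘ₗ f) :=
    isOpenQuotientMap_of_coinduced _ (P.mkQ_surjective.comp hf) rfl
  have : T2Space (M ⧸ P) :=
    (hA.isCanonicalTopology_of_isOpenQuotientMap _ hq').1.isCompactType.t2Space (L := L)
  have hc : Continuous P.mkQ := hq.continuous_comp_iff.1 hq'.continuous
  convert (isClosed_singleton (x := (0 : M ⧸ P))).preimage hc using 1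
  ext x
  simp

/-- Linear maps between finitely generated modules are continuous and strict: the subspace topology
of the range is a canonical topology, hence a quotient topology. -/
theorem continuous_and_isStrictMap [∀ m, IsNoetherianRing (B m)] [Module.Finite A M]
    (hA : IsCompactTypeAlgebra L φ ι) {N : Type uN} [AddCommGroup N] [Module A N] [Module L N]
    [IsScalarTower L A N] [Module.Finite A N] [τ : TopologicalSpace M] [σ : TopologicalSpace N]
    (hM : IsCanonicalTopology L A M τ) (hN : IsCanonicalTopology L A N σ) (f : M →ₗ[A] N) :
    Continuous f ∧ IsStrictMap f := by
  obtain ⟨n, g, hg⟩ := Module.Finite.exists_fin' A M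
  have hq : IsOpenQuotientMap g := hA.isOpenQuotientMap hM g hg
  have hc : Continuous f := hq.continuous_comp_iff.1 (hN.continuous_of_pi (f ∘ₗ g))
  have hR : IsCanonicalTopology L A (LinearMap.range f) inferInstance := by
    refine ⟨?_, ?_⟩
    · obtain ⟨V, _, _, ψ, j, hV⟩ := hN.isCompactType
      exact hV.exists_subspace ((LinearMap.range f).restrictScalars L)
        (hA.isClosed_submodule hN (LinearMap.range f))
    · exact (hN.continuous_smul.comp
        (continuous_fst.prodMk (continuous_subtype_val.comp continuous_snd))).subtype_mk _
  have hs := f.surjective_rangeRestrict.comp hg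
  have h := hA.isOpenQuotientMap hR (f.rangeRestrict ∘ₗ g) hs
  have hfr : IsOpenQuotientMap f.rangeRestrict := .of_comp hq.continuous hg (hc.subtype_mk _) h
  exact ⟨hc, hfr.isQuotientMap⟩

end IsCompactTypeAlgebra

end Modules

theorem proposition5p1
    (p : ℕ) [Fact p.Prime]
    (L : Type*) [NontriviallyNormedField L] [NormedAlgebra ℚ_[p] L] [FiniteDimensional ℚ_[p] L]
    -- the compact type algebra `A`, limit of the left noetherian Banach algebras `B m`
    (B : ℕ → Type*) [∀ m, NormedRing (B m)] [∀ m, NormedAlgebra L (B m)]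
    [∀ m, IsNoetherianRing (B m)]
    (A : Type*) [Ring A] [Algebra L A] [TopologicalSpace A]
    (φ : ∀ m, B m →ₐ[L] B (m + 1)) (ι : ∀ m, B m →ₐ[L] A)
    (hA : IsCompactTypeAlgebra L φ ι)
    -- the finitely generated left module `M`
    (M : Type uM) [AddCommGroup M] [Module A M] [Module L M] [IsScalarTower L A M]
    [Module.Finite A M] :
    -- (i)
    (∃! τ : TopologicalSpace M, IsCanonicalTopology L A M τ) ∧
    (∀ τ : TopologicalSpace M, IsCanonicalTopology L A M τ →
      ∃ (V : ℕ → Type uM) (_ : ∀ m, NormedAddCommGroup (V m)) (_ : ∀ m, NormedSpace L (V m))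
        (ψ : ∀ m, V m →ₗ[L] V (m + 1)) (j : ∀ m, V m →ₗ[L] M),
        IsCompactTypeLimit L ψ j ∧
        ∀ m, IsFGSubmoduleVia (ι m : B m →+* A) (Set.range (j m))) ∧
    -- (ii)
    (∀ τ : TopologicalSpace M, IsCanonicalTopology L A M τ →
      ∀ P : Submodule A M, P.FG → IsClosed[τ] (P : Set M)) ∧
    -- (iii)
    (∀ (N : Type uN) [AddCommGroup N] [Module A N] [Module L N] [IsScalarTower L A N]
      [Module.Finite A N] (f : M →ₗ[A] N) (τ : TopologicalSpace M) (σ : TopologicalSpace N),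
      IsCanonicalTopology L A M τ → IsCanonicalTopology L A N σ →
        Continuous[τ, σ] f ∧ Topology.IsStrictMap f ∧ IsClosed[σ] (Set.range f)) ∧
    -- (iv)
    (∀ (r s : ℕ) (g : (Fin s → A) →ₗ[A] (Fin r → A)) (f : (Fin r → A) →ₗ[A] M)
      (_ : Function.Exact g f) (hf : Function.Surjective f) (τ : TopologicalSpace M),
      IsCanonicalTopology L A M τ →
        TopologicalSpace.coinduced (f.quotKerEquivOfSurjective hf)
          (inferInstance : TopologicalSpace ((Fin r → A) ⧸ LinearMap.ker f)) = τ) := by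
  have := hA.isTopologicalRing
  -- every canonical topology is the quotient topology of any presentation by a free module
  have hco : ∀ {r : ℕ} (f : (Fin r → A) →ₗ[A] M), Function.Surjective f →
      ∀ τ : TopologicalSpace M, IsCanonicalTopology L A M τ → τ = .coinduced f inferInstance :=
    fun f hf τ hτ => (hA.isOpenQuotientMap hτ f hf).isQuotientMap.eq_coinduced
  obtain ⟨n, q, hq⟩ := Module.Finite.exists_fin' A M
  refine ⟨⟨.coinduced q inferInstance, ?_, hco q hq⟩, fun τ hτ => ?_,
    fun τ hτ P _ => hA.isClosed_submodule hτ P, fun N _ _ _ _ _ f τ σ hτ hσ => ?_,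
    fun r s g f _ hf τ hτ => ?_⟩
  · let : TopologicalSpace M := .coinduced q inferInstance
    exact (hA.isCanonicalTopology_of_isOpenQuotientMap q
      (isOpenQuotientMap_of_coinduced q hq rfl)).1
  · exact (hA.isCanonicalTopology_of_isOpenQuotientMap q (hA.isOpenQuotientMap hτ q hq)).2
  · obtain ⟨h1, h2⟩ := hA.continuous_and_isStrictMap hτ hσ f
    exact ⟨h1, h2, hA.isClosed_submodule hσ (LinearMap.range f)⟩
  · rw [hco f hf τ hτ]
    exact coinduced_compose
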